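/- Let $\mathcal H^R,\mathcal H^A,\mathcal H^{A'}$ be finite-dimensional Hilbert spaces, let $\mathcal H^B$ be a copy of $\mathcal H^{A'}$, and let $|\psi\rangle^{RAA'}\in\mathcal H^R\otimes\mathcal H^A\otimes\mathcal H^{A'}$ be any pure state (unit vector), with reduced state $\psi^{A'}=\operatorname{tr}_{RA}|\psi\rangle\langle\psi|^{RAA'}$. Let $K\ge 1$ be an integer and let $|\Phi_K^+\rangle^{\overline A\,\overline B}=\frac1{\sqrt K}\sum_{l=0}^{K-1}|l\rangle^{\overline A}\otimes|l\rangle^{\overline B}$ be a maximally entangled resource state of Schmidt rank $K$. Exact state splitting of $|\psi\rangle^{RAA'}$ with this resource is said to be achievable if there is an LOCC map $\mathcal S$ (local operations of a sender and a receiver and classical communication between them) in which the sender initially holds $A,A',\overline A$ and finally $A$, and the receiver initially holds $\overline B$ and finally $B$, such that $$\left(\mathrm{id}^R\otimes\mathcal S\right)\left(\psi^{RAA'}\otimes{\Phi_K^+}^{\overline A\,\overline B}\right)=\psi^{RAB},$$ where $\psi^{RAA'}=|\psi\rangle\langle\psi|^{RAA'}$, $\Phi_K^+=|\Phi_K^+\rangle\langle\Phi_K^+|$,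 and $\psi^{RAB}$ is the same state with $A'$ replaced by $B$. Here an LOCC map is the limit of the channels obtained by stopping, after finitely many rounds, a (possibly infinite) protocol of rounds in each of which one party applies a quantum instrument to its own system and announces the outcome and the other party applies a channel depending on it; finite-round protocols are included. Then exact state splitting of $|\psi\rangle^{RAA'}$ is achievable if and only if $$\log_2 K\ \ge\ \log_2\operatorname{rank}\psi^{A'}.$$ -/

import Mathlib

open scoped Kronecker Topology ComplexOrder

namespace QLOCC

/-! Finite-dimensional quantum systems are represented by finite index types: the system `m` is the
Hilbert space `ℂ^m` with its standard orthonormal basis, `Matrix m m ℂ` is the algebra of operators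
on it, and a composite system is a product of index types. -/

/-- The (super)operator `id_r ⊗ Φ`, which applies `Φ` to the second tensor factor. -/
def idTensor (r : Type) {m n : Type} (Φ : Matrix m m ℂ →ₗ[ℂ] Matrix n n ℂ) :
    Matrix (r × m) (r × m) ℂ →ₗ[ℂ] Matrix (r × n) (r × n) ℂ where
  toFun X := Matrix.of fun p q => Φ (Matrix.of fun x y => X (p.1, x) (q.1, y)) p.2 q.2
  map_add' X Y := by
    ext p q
    have h : (Matrix.of fun x y => (X + Y) (p.1, x) (q.1, y)) =
        (Matrix.of fun x y => X (p.1, x) (q.1, y)) +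
          (Matrix.of fun x y => Y (p.1, x) (q.1, y)) := rfl
    simp only [Matrix.of_apply, Matrix.add_apply] at h ⊢
    rw [h, map_add, Matrix.add_apply]
  map_smul' c X := by
    ext p q
    have h : (Matrix.of fun x y => (c • X) (p.1, x) (q.1, y)) =
        c • (Matrix.of fun x y => X (p.1, x) (q.1, y)) := rfl
    simp only [Matrix.of_apply, Matrix.smul_apply, RingHom.id_apply] at h ⊢
    rw [h, map_smul, Matrix.smul_apply]

/-- Complete positivity: `id_k ⊗ Φ` preserves positive semidefiniteness for every `k`. -/
def IsCP {m n : Type} (Φ : Matrix m m ℂ →ₗ[ℂ] Matrix n n ℂ) : Prop :=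
  ∀ (k : ℕ) (X : Matrix (Fin k × m) (Fin k × m) ℂ),
    X.PosSemidef → (idTensor (Fin k) Φ X).PosSemidef

/-- Completely positive and trace-preserving maps (quantum channels). -/
def IsCPTP {m n : Type} [Fintype m] [Fintype n]
    (Φ : Matrix m m ℂ →ₗ[ℂ] Matrix n n ℂ) : Prop :=
  IsCP Φ ∧ ∀ X, (Φ X).trace = X.trace

/-- `Φ = F ⊗ G`, as a statement about the values on product operators, which span. -/
def IsTensor {a b a' b' : Type} (Φ : Matrix (a × b) (a × b) ℂ →ₗ[ℂ] Matrix (a' × b') (a' × b') ℂ)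
    (F : Matrix a a ℂ →ₗ[ℂ] Matrix a' a' ℂ) (G : Matrix b b ℂ →ₗ[ℂ] Matrix b' b' ℂ) : Prop :=
  ∀ X Y, Φ (X ⊗ₖ Y) = F X ⊗ₖ G Y

/-- A quantum instrument from the system `m` to the system `n`: a finite or countably infinite
family of completely positive maps whose sum is trace-preserving. -/
structure Instrument (m n : Type) [Fintype m] [Fintype n] where
  /-- The set of classical outcomes. -/
  Outcome : Type
  countable_outcome : Countable Outcome
  /-- The completely positive map belonging to an outcome. -/
  map : Outcome → (Matrix m m ℂ →ₗ[ℂ] Matrix n n ℂ)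
  cp : ∀ i, IsCP (map i)
  tp : ∀ X, HasSum (fun i => (map i X).trace) X.trace

section LOCC

variable {a b a' b' a'' b'' : Type} [Fintype a] [Fintype b] [Fintype a'] [Fintype b']
  [Fintype a''] [Fintype b'']

/-- One-way local with respect to the first party: it applies an instrument to its own system and
broadcasts the outcome; the second party then applies a channel which depends on the outcome. -/
def Instrument.IsOneWayLocalFst (J : Instrument (a × b) (a' × b')) : Prop :=
  ∀ i, ∃ (F : Matrix a a ℂ →ₗ[ℂ] Matrix a' a' ℂ) (T : Matrix b b ℂ →ₗ[ℂ] Matrix b' b' ℂ),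
    IsCP F ∧ IsCPTP T ∧ IsTensor (J.map i) F T

/-- One-way local with respect to the second party. -/
def Instrument.IsOneWayLocalSnd (J : Instrument (a × b) (a' × b')) : Prop :=
  ∀ i, ∃ (T : Matrix a a ℂ →ₗ[ℂ] Matrix a' a' ℂ) (F : Matrix b b ℂ →ₗ[ℂ] Matrix b' b' ℂ),
    IsCPTP T ∧ IsCP F ∧ IsTensor (J.map i) T F

/-- One-way local with respect to one of the two parties. -/
def Instrument.IsOneWayLocal (J : Instrument (a × b) (a' × b')) : Prop :=
  J.IsOneWayLocalFst ∨ J.IsOneWayLocalSnd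

/-- `J'` is a coarse-graining of `J`: its maps are the sums of the maps of `J` over the blocks of a
partition of the outcomes. -/
def Instrument.IsCoarseGrainingOf {m n : Type} [Fintype m] [Fintype n]
    (J' J : Instrument m n) : Prop :=
  ∃ f : J.Outcome → J'.Outcome, ∀ k X,
    HasSum (fun i : {i // f i = k} => J.map i.1 X) (J'.map k X)

/-- `J'` is LOCC-linked to `J`: after `J` with outcome `j`, a one-way local instrument `P j` is
applied (the choice of the acting party may depend on `j`), and `J'` is a coarse-graining of the
resulting instrument, whose outcomes are the pairs `⟨j, i⟩`. The local systems may change. -/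
def Instrument.IsLinkedTo (J' : Instrument (a × b) (a'' × b''))
    (J : Instrument (a × b) (a' × b')) : Prop :=
  ∃ P : J.Outcome → Instrument (a' × b') (a'' × b''),
    (∀ j, (P j).IsOneWayLocal) ∧
    ∃ f : (Σ j, (P j).Outcome) → J'.Outcome, ∀ k X,
      HasSum (fun x : {x // f x = k} => (P x.1.1).map x.1.2 (J.map x.1.1 X)) (J'.map k X)

end LOCC

/-- Instruments that are implemented by LOCC protocols with finitely many rounds. -/
inductive IsFiniteLOCC {a b : Type} [Fintype a] [Fintype b] :
    ∀ {a' b' : Type} [Fintype a'] [Fintype b'], Instrument (a × b) (a' × b') → Prop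
  | one {a' b' : Type} [Fintype a'] [Fintype b'] (P J : Instrument (a × b) (a' × b')) :
      P.IsOneWayLocal → J.IsCoarseGrainingOf P → IsFiniteLOCC J
  | link {a' b' a'' b'' : Type} [Fintype a'] [Fintype b'] [Fintype a''] [Fintype b'']
      (J : Instrument (a × b) (a' × b')) (J' : Instrument (a × b) (a'' × b'')) :
      IsFiniteLOCC J → J'.IsLinkedTo J → IsFiniteLOCC J'

/-- The partial trace over the local workspaces `w` of the first and `v` of the second party. -/
def traceWork {a b w v : Type} [Fintype w] [Fintype v]
    (X : Matrix ((a × w) × (b × v)) ((a × w) × (b × v)) ℂ) : Matrix (a × b) (a × b) ℂ :=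
  Matrix.of fun p q => ∑ i, ∑ j, X ((p.1, i), (p.2, j)) ((q.1, i), (q.2, j))

/-- LOCC maps, from the bipartite system `a × b` to the bipartite system `a' × b'`. There is a
sequence of finite-round LOCC instruments `J 0, J 1, …`, each of which continues the preceding one
by a further round, with outputs in the output systems and additional local workspaces, such that
the channels `E ν`, obtained from `J ν` by forgetting all outcomes and discarding the workspaces,
converge to `S`. (A finite-round protocol is the case in which nothing is done from some round
on.) -/
def IsLOCC {a b a' b' : Type} [Fintype a] [Fintype b] [Fintype a'] [Fintype b']
    (S : Matrix (a × b) (a × b) ℂ →ₗ[ℂ] Matrix (a' × b') (a' × b') ℂ) : Prop :=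
  ∃ (w v : ℕ → ℕ) (J : ∀ ν, Instrument (a × b) ((a' × Fin (w ν)) × (b' × Fin (v ν))))
    (E : ℕ → (Matrix (a × b) (a × b) ℂ →ₗ[ℂ] Matrix (a' × b') (a' × b') ℂ)),
    (∀ ν, IsFiniteLOCC (J ν)) ∧
    (∀ ν, (J (ν + 1)).IsLinkedTo (J ν)) ∧
    (∀ ν X, HasSum (fun i => traceWork ((J ν).map i X)) (E ν X)) ∧
    ∀ X, Filter.Tendsto (fun ν => E ν X) Filter.atTop (𝓝 (S X))

/-- The operator `|v⟩⟨v|`. -/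
def ketbra {n : Type} (v : n → ℂ) : Matrix n n ℂ := Matrix.vecMulVec v (star v)

/-- The partial trace over the first tensor factor. -/
def traceFst {m n : Type} [Fintype m] (X : Matrix (m × n) (m × n) ℂ) : Matrix n n ℂ :=
  Matrix.of fun x y => ∑ i, X (i, x) (i, y)

/-- The maximally entangled vector `K^{-1/2} ∑ₗ |l⟩ ⊗ |l⟩`. -/
noncomputable def maxEntangled (K : ℕ) : Fin K × Fin K → ℂ :=
  fun p => if p.1 = p.2 then ((1 / Real.sqrt K : ℝ) : ℂ) else 0

/-- The vector `|ψ⟩^{R A A'} ⊗ |Φ_K⟩`, with its tensor factors grouped into the reference `R`, the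
sender's system `(A A') Ā` and the receiver's system `B̄`. -/
noncomputable def splittingInput {r a a' : Type} (K : ℕ) (ψ : r × a × a' → ℂ) :
    r × (((a × a') × Fin K) × Fin K) → ℂ :=
  fun p => ψ (p.1, p.2.1.1.1, p.2.1.1.2) * maxEntangled K (p.2.1.2, p.2.2)

/-- Exact state splitting of `|ψ⟩^{R A A'}` with a maximally entangled resource state of Schmidt
rank `K` is achievable: some LOCC map `S` of the sender (initially `A A' Ā`, finally `A`) and the
receiver (initially `B̄`, finally `B`, a copy of `A'`) satisfies
`(id^R ⊗ S) (ψ^{R A A'} ⊗ Φ_K) = ψ^{R A B}`. -/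
def SplittingAchievable {r a a' : Type} [Fintype a] [Fintype a']
    (K : ℕ) (ψ : r × a × a' → ℂ) : Prop :=
  ∃ S : Matrix (((a × a') × Fin K) × Fin K) (((a × a') × Fin K) × Fin K) ℂ →ₗ[ℂ]
      Matrix (a × a') (a × a') ℂ,
    IsLOCC S ∧ idTensor r S (ketbra (splittingInput K ψ)) = ketbra ψ

/-- The reduced state `ψ^{A'}` of `|ψ⟩^{R A A'}`. -/
def reducedLast {r a a' : Type} [Fintype r] [Fintype a]
    (ψ : r × a × a' → ℂ) : Matrix a' a' ℂ :=
  traceFst (traceFst (ketbra ψ))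

end QLOCC

/-! Necessity. Across the cut `(R, sender) : receiver` the input has Schmidt rank at most `K`, since
only the resource state crosses the cut. Outcome maps of one-way local instruments have product
Kraus operators, which act termwise on a sum of `K` product vectors. Composition, coarse-graining
(possibly over infinitely many outcomes), discarding workspaces and the limit over rounds stay in
the closed convex cone generated by the `|v⟩⟨v|` of Schmidt rank at most `K`
(`IsLOCC.preservesSchmidtNumberLE`). So the output `|ψ⟩⟨ψ|` lies in this cone. A pure state of
larger Schmidt rank is excluded by a witness `c • 1 - |ψ⟩⟨ψ|` with `c < 1`, whose existence follows
from compactness (`exists_overlap_bound`, `SchmidtNumberLE.rank_le`). The Schmidt rank of `ψ` is the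
rank of `ψ^{A'}`.

Sufficiency. If the rank is at most `K`, the support of `ψ^{A'}` fits into `ℂ^K` through a partial
isometry (`exists_partialIsometry`), and the compressed system is teleported with the generalized
Pauli operators (`exists_orthogonal_unitary_basis`). Measurement outcomes outside the support have
probability zero, so one round suffices. -/

namespace QLOCC

/-! ### Maps in Kraus form -/

/-- The completely positive map `X ↦ ∑ᵢ Lᵢ X Lᵢ†` with the Kraus operators `L`. -/
def krausMap {ι m n : Type} [Fintype ι] [Fintype m] (L : ι → Matrix n m ℂ) :
    Matrix m m ℂ →ₗ[ℂ] Matrix n n ℂ where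
  toFun X := ∑ i, L i * X * (L i).conjTranspose
  map_add' X Y := by simp [Matrix.mul_add, Matrix.add_mul, Finset.sum_add_distrib]
  map_smul' c X := by simp [Finset.smul_sum]

theorem krausMap_apply {ι m n : Type} [Fintype ι] [Fintype m] (L : ι → Matrix n m ℂ)
    (X : Matrix m m ℂ) : krausMap L X = ∑ i, L i * X * (L i).conjTranspose := rfl

theorem mul_ketbra_mul {m n : Type} [Fintype m] (L : Matrix n m ℂ) (v : m → ℂ) :
    L * ketbra v * L.conjTranspose = ketbra (L.mulVec v) := by
  rw [ketbra, ketbra, Matrix.mul_vecMulVec, Matrix.vecMulVec_mul, Matrix.star_mulVec]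

theorem krausMap_ketbra {ι m n : Type} [Fintype ι] [Fintype m] (L : ι → Matrix n m ℂ)
    (v : m → ℂ) : krausMap L (ketbra v) = ∑ i, ketbra ((L i).mulVec v) := by
  simp only [krausMap_apply, mul_ketbra_mul]

theorem posSemidef_krausMap {ι m n : Type} [Fintype ι] [Fintype m] [Fintype n]
    (L : ι → Matrix n m ℂ) {X : Matrix m m ℂ} (hX : X.PosSemidef) :
    (krausMap L X).PosSemidef := by
  rw [krausMap_apply]
  exact Matrix.posSemidef_sum _ fun i _ => hX.mul_mul_conjTranspose_same (L i)

theorem krausMap_entry {ι m n : Type} [Fintype ι] [Fintype m] (L : ι → Matrix n m ℂ)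
    (X : Matrix m m ℂ) (p q : n) :
    krausMap L X p q = ∑ i, ∑ x, ∑ y, L i p x * X x y * star (L i q y) := by
  simp only [krausMap_apply, Matrix.sum_apply, Matrix.mul_apply, Matrix.conjTranspose_apply,
    Finset.sum_mul]
  exact Finset.sum_congr rfl fun i _ => Finset.sum_comm

theorem idTensor_krausMap {ι m n r : Type} [Fintype ι] [Fintype m] [Fintype r] [DecidableEq r]
    (L : ι → Matrix n m ℂ) :
    idTensor r (krausMap L) = krausMap fun i => (1 : Matrix r r ℂ) ⊗ₖ L i := by
  refine LinearMap.ext fun X => ?_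
  ext ⟨i, p⟩ ⟨j, q⟩
  change krausMap L (Matrix.of fun x y => X (i, x) (j, y)) p q = _
  simp only [krausMap_entry, Fintype.sum_prod_type, Matrix.kroneckerMap_apply, Matrix.one_apply,
    Matrix.of_apply]
  refine Finset.sum_congr rfl fun s _ => ?_
  rw [Finset.sum_eq_single i (fun b _ hb => by simp [hb.symm]) (by simp)]
  refine Finset.sum_congr rfl fun x _ => ?_
  rw [Finset.sum_eq_single j (fun b _ hb => by simp [hb.symm]) (by simp)]
  simp

theorem isCP_krausMap {ι m n : Type} [Fintype ι] [Fintype m] [Fintype n]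
    (L : ι → Matrix n m ℂ) : IsCP (krausMap L) := by
  intro k X hX
  rw [idTensor_krausMap]
  exact posSemidef_krausMap _ hX

theorem trace_krausMap {ι m n : Type} [Fintype ι] [Fintype m] [Fintype n]
    (L : ι → Matrix n m ℂ) (X : Matrix m m ℂ) :
    (krausMap L X).trace = ((∑ i, (L i).conjTranspose * L i) * X).trace := by
  rw [krausMap_apply, Matrix.trace_sum, Finset.sum_mul, Matrix.trace_sum]
  exact Finset.sum_congr rfl fun i _ => by rw [Matrix.trace_mul_comm, Matrix.mul_assoc]

theorem isCPTP_krausMap {ι m n : Type} [Fintype ι] [Fintype m] [Fintype n] [DecidableEq m]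
    (L : ι → Matrix n m ℂ) (h : ∑ i, (L i).conjTranspose * L i = 1) : IsCPTP (krausMap L) :=
  ⟨isCP_krausMap L, fun X => by rw [trace_krausMap, h, Matrix.one_mul]⟩

theorem isTensor_krausMap {ι κ a b a' b' : Type} [Fintype ι] [Fintype κ] [Fintype a] [Fintype b]
    (M : ι → Matrix a' a ℂ) (L : κ → Matrix b' b ℂ) :
    IsTensor (krausMap fun p : ι × κ => M p.1 ⊗ₖ L p.2) (krausMap M) (krausMap L) := by
  intro X Y
  ext ⟨i, j⟩ ⟨i', j'⟩
  simp only [krausMap_apply, Matrix.conjTranspose_kronecker, ← Matrix.mul_kronecker_mul,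
    Fintype.sum_prod_type, Matrix.sum_apply, Matrix.kroneckerMap_apply, Finset.sum_mul_sum]

/-- Matrix units of a composite system are products of matrix units, so the product operators span.
-/
theorem IsTensor.unique {a b a' b' : Type} [Fintype a] [Fintype b]
    {Φ Ψ : Matrix (a × b) (a × b) ℂ →ₗ[ℂ] Matrix (a' × b') (a' × b') ℂ}
    {F : Matrix a a ℂ →ₗ[ℂ] Matrix a' a' ℂ} {G : Matrix b b ℂ →ₗ[ℂ] Matrix b' b' ℂ}
    (hΦ : IsTensor Φ F G) (hΨ : IsTensor Ψ F G) : Φ = Ψ := by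
  classical
  refine LinearMap.ext fun X => ?_
  rw [Matrix.matrix_eq_sum_single X]
  simp only [map_sum]
  refine Finset.sum_congr rfl fun p _ => Finset.sum_congr rfl fun q _ => ?_
  have h : Matrix.single p q (X p q) =
      Matrix.single p.1 q.1 (X p q) ⊗ₖ Matrix.single p.2 q.2 (1 : ℂ) := by
    rw [Matrix.single_kronecker_single]; simp
  rw [h, hΦ, hΨ]

open scoped MatrixOrder Matrix.Norms.L2Operator in
theorem _root_.Matrix.PosSemidef.exists_conjTranspose_mul_self {n : Type} [Fintype n]
    {A : Matrix n n ℂ} (hA : A.PosSemidef) : ∃ B : Matrix n n ℂ, A = B.conjTranspose * B := by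
  classical
  exact CStarAlgebra.nonneg_iff_eq_star_mul_self.mp hA.nonneg

/-- Every completely positive map has a Kraus form. -/
theorem IsCP.exists_krausMap {m n : Type} [Fintype m] [Fintype n]
    {F : Matrix m m ℂ →ₗ[ℂ] Matrix n n ℂ} (hF : IsCP F) :
    ∃ (ι : Type) (_ : Fintype ι) (L : ι → Matrix n m ℂ), F = krausMap L := by
  classical
  let e := Fintype.equivFin m
  -- `u` is the unnormalized maximally entangled vector, so `hC` below says that the Choi matrix of
  -- `F` is positive.
  let u : Fin (Fintype.card m) × m → ℂ := fun p => if p.1 = e p.2 then 1 else 0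
  have hpos : (ketbra u).PosSemidef := Matrix.posSemidef_vecMulVec_self_star u
  have hC := hF _ _ hpos
  obtain ⟨B, hB⟩ := hC.exists_conjTranspose_mul_self
  -- Each row of `B`, conjugated and reshaped, is a Kraus operator.
  refine ⟨_, inferInstance, fun s => Matrix.of fun p x => star (B s (e x, p)), ?_⟩
  have key : ∀ x y p q, F (Matrix.single x y 1) p q = ∑ s, star (B s (e x, p)) * B s (e y, q) := by
    intro x y p q
    have h1 : idTensor (Fin (Fintype.card m)) F (ketbra u) (e x, p) (e y, q) =
        F (Matrix.single x y 1) p q := by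
      change F (Matrix.of fun x' y' => ketbra u (e x, x') (e y, y')) p q = _
      refine congrArg (fun Z => F Z p q) (Matrix.ext fun x' y' => ?_)
      simp only [ketbra, Matrix.vecMulVec_apply, Matrix.of_apply, u, Matrix.single_apply,
        Pi.star_apply, EmbeddingLike.apply_eq_iff_eq]
      by_cases h1 : x = x' <;> by_cases h2 : y = y' <;> simp [h1, h2]
    rw [← h1, hB]
    rfl
  refine LinearMap.ext fun X => ?_
  conv_lhs => rw [Matrix.matrix_eq_sum_single X]
  ext p q
  simp only [map_sum, Matrix.sum_apply, krausMap_entry, Matrix.of_apply, star_star]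
  have h2 : ∀ x y, F (Matrix.single x y (X x y)) p q = X x y * F (Matrix.single x y 1) p q := by
    intro x y
    have : Matrix.single x y (X x y) = X x y • Matrix.single x y (1 : ℂ) := by
      rw [Matrix.smul_single]; simp
    rw [this, map_smul]; rfl
  simp only [h2, key, Finset.mul_sum]
  rw [Finset.sum_comm]
  refine (Finset.sum_congr rfl fun y _ => Finset.sum_comm).trans ?_
  rw [Finset.sum_comm]
  refine Finset.sum_congr rfl fun s _ => ?_
  rw [Finset.sum_comm]
  exact Finset.sum_congr rfl fun x _ => Finset.sum_congr rfl fun y _ => by ring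

/-! ### Schmidt number is not increased by LOCC maps -/

/-- The vector `v`, of the system `(r α) : β`, is a sum of `K` product vectors. -/
def SchmidtRankLE {r α β : Type} (K : ℕ) (v : r × (α × β) → ℂ) : Prop :=
  ∃ (f : Fin K → r × α → ℂ) (g : Fin K → β → ℂ),
    ∀ i x y, v (i, (x, y)) = ∑ l, f l (i, x) * g l y

/-- The operator `X` belongs to the closed convex cone that is generated by the `|v⟩⟨v|` with
`v` of Schmidt rank at most `K`; the cone is described by its dual. -/
def SchmidtNumberLE {r α β : Type} (K : ℕ)
    (X : Matrix (r × (α × β)) (r × (α × β)) ℂ) : Prop :=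
  ∀ f : Matrix (r × (α × β)) (r × (α × β)) ℂ →ₗ[ℂ] ℂ,
    (∀ v, SchmidtRankLE K v → 0 ≤ (f (ketbra v)).re) → 0 ≤ (f X).re

/-- The map `id_r ⊗ Φ` does not increase Schmidt numbers above `K`. -/
def PreservesSchmidtNumberLE (r : Type) {α β α' β' : Type} (K : ℕ)
    (Φ : Matrix (α × β) (α × β) ℂ →ₗ[ℂ] Matrix (α' × β') (α' × β') ℂ) : Prop :=
  ∀ X : Matrix (r × (α × β)) (r × (α × β)) ℂ,
    SchmidtNumberLE K X → SchmidtNumberLE K (idTensor r Φ X)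

theorem SchmidtRankLE.schmidtNumberLE {r α β : Type} {K : ℕ} {v : r × (α × β) → ℂ}
    (hv : SchmidtRankLE K v) : SchmidtNumberLE K (ketbra v) :=
  fun _ hf => hf v hv

theorem SchmidtNumberLE.sum {ι r α β : Type} {K : ℕ} (s : Finset ι)
    {X : ι → Matrix (r × (α × β)) (r × (α × β)) ℂ} (h : ∀ i, SchmidtNumberLE K (X i)) :
    SchmidtNumberLE K (∑ i ∈ s, X i) := by
  intro f hf
  rw [map_sum, Complex.re_sum]
  exact Finset.sum_nonneg fun i _ => h i f hf

/-- Closedness comes with the dual description, as linear functionals are continuous in finite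
dimension. -/
theorem SchmidtNumberLE.of_tendsto {ι r α β : Type} [Finite r] [Finite α] [Finite β] {K : ℕ}
    {l : Filter ι} [l.NeBot] {X : ι → Matrix (r × (α × β)) (r × (α × β)) ℂ}
    {Y : Matrix (r × (α × β)) (r × (α × β)) ℂ} (hX : ∀ i, SchmidtNumberLE K (X i))
    (hY : Filter.Tendsto X l (𝓝 Y)) : SchmidtNumberLE K Y := by
  intro f hf
  have hc : Continuous f := f.continuous_of_finiteDimensional
  exact ge_of_tendsto' ((Complex.continuous_re.comp hc).tendsto Y |>.comp hY)
    fun i => hX i f hf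

theorem SchmidtRankLE.mulVec {r α β α' β' : Type} [Fintype r] [Fintype α] [Fintype β]
    [DecidableEq r] {K : ℕ} {v : r × (α × β) → ℂ} (hv : SchmidtRankLE K v)
    (M : Matrix α' α ℂ) (L : Matrix β' β ℂ) :
    SchmidtRankLE K (((1 : Matrix r r ℂ) ⊗ₖ (M ⊗ₖ L)).mulVec v) := by
  obtain ⟨f, g, h⟩ := hv
  refine ⟨fun l p => ∑ x, M p.2 x * f l (p.1, x), fun l => L.mulVec (g l), fun i x y => ?_⟩
  simp only [Matrix.mulVec, dotProduct, Fintype.sum_prod_type, Matrix.kroneckerMap_apply,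
    Matrix.one_apply, h]
  rw [Finset.sum_eq_single i (fun b _ hb => by simp [hb.symm]) (by simp)]
  simp only [if_true, one_mul, Finset.sum_mul_sum]
  simp only [Finset.mul_sum]
  rw [Finset.sum_comm_cycle]
  exact Finset.sum_congr rfl fun l _ => Finset.sum_congr rfl fun a _ =>
    Finset.sum_congr rfl fun b _ => by ring

/-- Pure states suffice: a functional nonnegative on the generators pulls back along `id ⊗ Φ` to
another such functional. -/
theorem preservesSchmidtNumberLE_of_ketbra {r α β α' β' : Type} {K : ℕ}
    {Φ : Matrix (α × β) (α × β) ℂ →ₗ[ℂ] Matrix (α' × β') (α' × β') ℂ}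
    (h : ∀ v, SchmidtRankLE K v → SchmidtNumberLE K (idTensor r Φ (ketbra v))) :
    PreservesSchmidtNumberLE r K Φ :=
  fun _ hX f hf => hX (f ∘ₗ idTensor r Φ) fun v hv => h v hv f hf

theorem preservesSchmidtNumberLE_krausMap {ι r α β α' β' : Type} [Fintype ι] [Fintype r]
    [Fintype α] [Fintype β] (K : ℕ) (M : ι → Matrix α' α ℂ) (L : ι → Matrix β' β ℂ) :
    PreservesSchmidtNumberLE r K (krausMap fun i => M i ⊗ₖ L i) := by
  classical
  refine preservesSchmidtNumberLE_of_ketbra fun v hv => ?_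
  rw [idTensor_krausMap, krausMap_ketbra]
  exact SchmidtNumberLE.sum _ fun i => (hv.mulVec _ _).schmidtNumberLE

theorem IsTensor.preservesSchmidtNumberLE {r α β α' β' : Type} [Fintype r]
    [Fintype α] [Fintype β] [Fintype α'] [Fintype β'] (K : ℕ)
    {Φ : Matrix (α × β) (α × β) ℂ →ₗ[ℂ] Matrix (α' × β') (α' × β') ℂ}
    {F : Matrix α α ℂ →ₗ[ℂ] Matrix α' α' ℂ} {G : Matrix β β ℂ →ₗ[ℂ] Matrix β' β' ℂ}
    (h : IsTensor Φ F G) (hF : IsCP F) (hG : IsCP G) : PreservesSchmidtNumberLE r K Φ := by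
  obtain ⟨ι, _, M, rfl⟩ := hF.exists_krausMap
  obtain ⟨κ, _, L, rfl⟩ := hG.exists_krausMap
  rw [h.unique (isTensor_krausMap M L)]
  exact preservesSchmidtNumberLE_krausMap K _ _

theorem Instrument.IsOneWayLocal.preservesSchmidtNumberLE {r α β α' β' : Type} [Fintype r]
    [Fintype α] [Fintype β] [Fintype α'] [Fintype β'] (K : ℕ)
    {J : Instrument (α × β) (α' × β')} (hJ : J.IsOneWayLocal) (i : J.Outcome) :
    PreservesSchmidtNumberLE r K (J.map i) := by
  rcases hJ with hJ | hJ
  · obtain ⟨F, T, hF, hT, h⟩ := hJ i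
    exact h.preservesSchmidtNumberLE K hF hT.1
  · obtain ⟨T, F, hT, hF, h⟩ := hJ i
    exact h.preservesSchmidtNumberLE K hT.1 hF

theorem tendsto_idTensor {ι r m n : Type} {l : Filter ι}
    {Φ : ι → (Matrix m m ℂ →ₗ[ℂ] Matrix n n ℂ)} {Ψ : Matrix m m ℂ →ₗ[ℂ] Matrix n n ℂ}
    (h : ∀ X, Filter.Tendsto (fun i => Φ i X) l (𝓝 (Ψ X))) (X : Matrix (r × m) (r × m) ℂ) :
    Filter.Tendsto (fun i => idTensor r (Φ i) X) l (𝓝 (idTensor r Ψ X)) := by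
  refine tendsto_pi_nhds.2 fun p => tendsto_pi_nhds.2 fun q => ?_
  exact tendsto_pi_nhds.1 (tendsto_pi_nhds.1
    (h (Matrix.of fun x y => X (p.1, x) (q.1, y))) p.2) q.2

theorem PreservesSchmidtNumberLE.of_tendsto {ι r α β α' β' : Type} [Finite r] [Finite α']
    [Finite β'] {K : ℕ} {l : Filter ι} [l.NeBot]
    {Φ : ι → (Matrix (α × β) (α × β) ℂ →ₗ[ℂ] Matrix (α' × β') (α' × β') ℂ)}
    {Ψ : Matrix (α × β) (α × β) ℂ →ₗ[ℂ] Matrix (α' × β') (α' × β') ℂ}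
    (hΦ : ∀ i, PreservesSchmidtNumberLE r K (Φ i))
    (h : ∀ X, Filter.Tendsto (fun i => Φ i X) l (𝓝 (Ψ X))) :
    PreservesSchmidtNumberLE r K Ψ :=
  fun X hX => SchmidtNumberLE.of_tendsto (fun i => hΦ i X hX) (tendsto_idTensor h X)

theorem idTensor_sum {ι r m n : Type} (s : Finset ι)
    (Φ : ι → (Matrix m m ℂ →ₗ[ℂ] Matrix n n ℂ)) (X : Matrix (r × m) (r × m) ℂ) :
    idTensor r (∑ i ∈ s, Φ i) X = ∑ i ∈ s, idTensor r (Φ i) X := by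
  ext p q
  simp [idTensor, Matrix.sum_apply, LinearMap.sum_apply]

/-- Finite partial sums stay in the cone by convexity and the total by closedness, which covers
instruments with infinitely many outcomes. -/
theorem PreservesSchmidtNumberLE.of_hasSum {ι r α β α' β' : Type} [Finite r] [Finite α']
    [Finite β'] {K : ℕ}
    {Φ : ι → (Matrix (α × β) (α × β) ℂ →ₗ[ℂ] Matrix (α' × β') (α' × β') ℂ)}
    {Ψ : Matrix (α × β) (α × β) ℂ →ₗ[ℂ] Matrix (α' × β') (α' × β') ℂ}
    (hΦ : ∀ i, PreservesSchmidtNumberLE r K (Φ i))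
    (h : ∀ X, HasSum (fun i => Φ i X) (Ψ X)) : PreservesSchmidtNumberLE r K Ψ := by
  refine PreservesSchmidtNumberLE.of_tendsto (l := Filter.atTop)
    (Φ := fun s : Finset ι => ∑ i ∈ s, Φ i) (fun s X hX => ?_) fun X => ?_
  · rw [idTensor_sum]
    exact SchmidtNumberLE.sum _ fun i => hΦ i X hX
  · simpa [HasSum, LinearMap.sum_apply] using h X

theorem PreservesSchmidtNumberLE.comp {r α β α' β' α'' β'' : Type} {K : ℕ}
    {Φ : Matrix (α' × β') (α' × β') ℂ →ₗ[ℂ] Matrix (α'' × β'') (α'' × β'') ℂ}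
    {Ψ : Matrix (α × β) (α × β) ℂ →ₗ[ℂ] Matrix (α' × β') (α' × β') ℂ}
    (hΦ : PreservesSchmidtNumberLE r K Φ) (hΨ : PreservesSchmidtNumberLE r K Ψ) :
    PreservesSchmidtNumberLE r K (Φ ∘ₗ Ψ) :=
  fun X hX => hΦ _ (hΨ X hX)

theorem IsFiniteLOCC.preservesSchmidtNumberLE {r α β : Type} [Fintype r] [Fintype α]
    [Fintype β] (K : ℕ) {α' β' : Type} [Fintype α'] [Fintype β']
    {J : Instrument (α × β) (α' × β')} (hJ : IsFiniteLOCC J) :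
    ∀ k, PreservesSchmidtNumberLE r K (J.map k) := by
  induction hJ with
  | one P J hP hJ =>
    obtain ⟨f, hf⟩ := hJ
    exact fun k => PreservesSchmidtNumberLE.of_hasSum
      (fun i : {i // f i = k} => hP.preservesSchmidtNumberLE K i.1) (hf k)
  | link J J' _ hJ' ih =>
    obtain ⟨P, hP, f, hf⟩ := hJ'
    exact fun k => PreservesSchmidtNumberLE.of_hasSum
      (Φ := fun x : {x // f x = k} => (P x.1.1).map x.1.2 ∘ₗ J.map x.1.1)
      (fun x => ((hP x.1.1).preservesSchmidtNumberLE K x.1.2).comp (ih x.1.1)) (hf k)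

/-- Discarding workspaces is a local operation: its Kraus operators are the products `(1 ⊗ ⟨i|) ⊗ (1
⊗ ⟨j|)`. -/
theorem traceWork_eq_krausMap {α β w v : Type} [Fintype w] [Fintype v] [Fintype α] [Fintype β]
    [DecidableEq α] [DecidableEq β] [DecidableEq w] [DecidableEq v]
    (X : Matrix ((α × w) × (β × v)) ((α × w) × (β × v)) ℂ) :
    traceWork X = krausMap (fun p : w × v =>
      (Matrix.of fun x y => if y = (x, p.1) then 1 else 0 : Matrix α (α × w) ℂ) ⊗ₖ
        (Matrix.of fun x y => if y = (x, p.2) then 1 else 0 : Matrix β (β × v) ℂ)) X := by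
  ext ⟨x, y⟩ ⟨x', y'⟩
  rw [krausMap_entry]
  change ∑ i, ∑ j, X ((x, i), (y, j)) ((x', i), (y', j)) = _
  rw [Fintype.sum_prod_type]
  refine Finset.sum_congr rfl fun i _ => Finset.sum_congr rfl fun j _ => ?_
  rw [Finset.sum_eq_single ((x, i), (y, j)), Finset.sum_eq_single ((x', i), (y', j))]
  · simp
  · rintro ⟨b, c⟩ _ hb
    by_cases h : b = (x', i) <;> by_cases h' : c = (y', j) <;> simp_all
  · simp
  · rintro ⟨b, c⟩ _ hb
    refine Finset.sum_eq_zero fun _ _ => ?_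
    by_cases h : b = (x, i) <;> by_cases h' : c = (y, j) <;> simp_all
  · simp

theorem IsLOCC.preservesSchmidtNumberLE {r α β α' β' : Type} [Fintype r] [Fintype α]
    [Fintype β] [Fintype α'] [Fintype β'] (K : ℕ)
    {S : Matrix (α × β) (α × β) ℂ →ₗ[ℂ] Matrix (α' × β') (α' × β') ℂ} (hS : IsLOCC S) :
    PreservesSchmidtNumberLE r K S := by
  classical
  obtain ⟨w, v, J, E, hJ, -, hE, hlim⟩ := hS
  refine PreservesSchmidtNumberLE.of_tendsto (fun ν => ?_) hlim
  simp only [traceWork_eq_krausMap] at hE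
  exact PreservesSchmidtNumberLE.of_hasSum (Φ := fun i => _ ∘ₗ (J ν).map i)
    (fun i => (preservesSchmidtNumberLE_krausMap K _ _).comp
      ((hJ ν).preservesSchmidtNumberLE K i)) (hE ν)

/-- The receiver holds only `B̄`, of dimension `K`; expanding in its standard basis gives the `K`
product terms. -/
theorem schmidtRankLE_splittingInput {r a a' : Type} (K : ℕ) (ψ : r × a × a' → ℂ) :
    SchmidtRankLE K (splittingInput K ψ) := by
  refine ⟨fun l p => ψ (p.1, p.2.1.1, p.2.1.2) * maxEntangled K (p.2.2, l),
    fun l m => if m = l then 1 else 0, fun i x y => ?_⟩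
  simp [splittingInput]

/-! ### Pure states whose Schmidt number is at most `K` -/

/-- The matrix of a vector of the system `(r α) : β`. -/
def schmidtMatrix {r α β : Type} (v : r × (α × β) → ℂ) : Matrix (r × α) β ℂ :=
  Matrix.of fun p y => v (p.1, (p.2, y))

theorem SchmidtRankLE.rank_le {r α β : Type} [Fintype r] [Fintype α] [Fintype β] {K : ℕ}
    {v : r × (α × β) → ℂ} (hv : SchmidtRankLE K v) : (schmidtMatrix v).rank ≤ K := by
  obtain ⟨f, g, h⟩ := hv
  have : schmidtMatrix v = (Matrix.of fun p l => f l p : Matrix (r × α) (Fin K) ℂ) *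
      (Matrix.of g : Matrix (Fin K) β ℂ) := by
    ext ⟨i, x⟩ y
    simp [schmidtMatrix, h, Matrix.mul_apply]
  rw [this]
  exact (Matrix.rank_mul_le_left _ _).trans
    ((Matrix.rank_le_card_width _).trans_eq (Fintype.card_fin K))

theorem rank_reducedLast {r a a' : Type} [Fintype r] [Fintype a] [Fintype a']
    (ψ : r × a × a' → ℂ) : (reducedLast ψ).rank = (schmidtMatrix ψ).rank := by
  have : reducedLast ψ = (schmidtMatrix ψ).transpose *
      ((schmidtMatrix ψ).transpose).conjTranspose := by
    ext x y
    simp only [reducedLast, traceFst, ketbra, Matrix.vecMulVec_apply, Matrix.of_apply,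
      Matrix.mul_apply, Matrix.transpose_apply, Matrix.conjTranspose_apply, schmidtMatrix,
      Fintype.sum_prod_type, Pi.star_apply]
    exact Finset.sum_comm
  rw [this, Matrix.rank_self_mul_conjTranspose, Matrix.rank_transpose]

/-- Rank is lower semicontinuous, so rank at least `K + 1` is an open condition. -/
theorem isClosed_rank_le {r α β : Type} [Fintype r] [Fintype α] [Fintype β] (K : ℕ) :
    IsClosed {v : EuclideanSpace ℂ (r × (α × β)) | (schmidtMatrix fun p => v p).rank ≤ K} := by
  classical
  let T : EuclideanSpace ℂ (r × (α × β)) →ₗ[ℂ] ((β → ℂ) →L[ℂ] (r × α → ℂ)) :=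
    { toFun := fun v => LinearMap.toContinuousLinearMap (schmidtMatrix fun p => v p).mulVecLin
      map_add' := fun v w => by
        ext x p
        simp [schmidtMatrix, Matrix.mulVec, dotProduct, add_mul, Finset.sum_add_distrib]
      map_smul' := fun c v => by
        ext x p
        simp [schmidtMatrix, Matrix.mulVec, dotProduct, Finset.mul_sum, mul_assoc] }
  have hT : Continuous T := T.continuous_of_finiteDimensional
  have ho := (isOpen_setOfPred_nat_le_rank (𝕜 := ℂ) (E := β → ℂ) (F := r × α → ℂ) (K + 1)).preimage
    hT
  rw [← isOpen_compl_iff]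
  convert ho using 1
  ext v
  simp only [Set.mem_compl_iff, Set.mem_ofPred_eq, not_le, Set.mem_preimage]
  have : ((T v : (β → ℂ) →L[ℂ] (r × α → ℂ)) : (β → ℂ) →ₗ[ℂ] (r × α → ℂ)).rank =
      ((schmidtMatrix fun p => v p).rank : Cardinal) := by
    rw [Matrix.rank, Module.finrank_eq_rank]; rfl
  rw [this]
  exact_mod_cast Nat.lt_iff_add_one_le

theorem rank_schmidtMatrix_smul_le {r α β : Type} [Fintype r] [Fintype α] [Fintype β]
    (c : ℂ) (v : EuclideanSpace ℂ (r × (α × β))) :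
    (schmidtMatrix fun p => (c • v) p).rank ≤ (schmidtMatrix fun p => v p).rank := by
  classical
  have : (schmidtMatrix fun p => (c • v) p) =
      (schmidtMatrix fun p => v p) * (c • (1 : Matrix β β ℂ)) := by
    ext p q
    simp [schmidtMatrix]
  rw [this]
  exact Matrix.rank_mul_le_left _ _

/-- A unit vector of Schmidt rank greater than `K` has overlap bounded away from `1` with the
unit vectors of Schmidt rank at most `K`. -/
theorem exists_overlap_bound {r α β : Type} [Fintype r] [Fintype α] [Fintype β] {K : ℕ}
    {ψ : EuclideanSpace ℂ (r × (α × β))} (hψ : ‖ψ‖ = 1)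
    (hK : K < (schmidtMatrix fun p => ψ p).rank) :
    ∃ c < (1 : ℝ), ∀ v : EuclideanSpace ℂ (r × (α × β)),
      (schmidtMatrix fun p => v p).rank ≤ K → ‖inner ℂ ψ v‖ ^ 2 ≤ c * ‖v‖ ^ 2 := by
  let s : Set (EuclideanSpace ℂ (r × (α × β))) :=
    Metric.sphere 0 1 ∩ {v | (schmidtMatrix fun p => v p).rank ≤ K}
  have hs : IsCompact s := (isCompact_sphere _ _).inter_right (isClosed_rank_le K)
  have main : ∃ c < (1 : ℝ), ∀ v ∈ s, ‖inner ℂ ψ v‖ ^ 2 ≤ c := by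
    rcases s.eq_empty_or_nonempty with h | h
    · exact ⟨0, one_pos, by simp [h]⟩
    obtain ⟨v, hv, hmax⟩ := hs.exists_isMaxOn h
      (f := fun v => ‖inner ℂ ψ v‖ ^ 2) (by fun_prop)
    refine ⟨_, ?_, fun w hw => hmax hw⟩
    have hv1 : ‖v‖ = 1 := by simpa using hv.1
    have hle : ‖inner ℂ ψ v‖ ≤ 1 := by simpa [hψ, hv1] using norm_inner_le_norm (𝕜 := ℂ) ψ v
    refine pow_lt_one₀ (norm_nonneg _) (lt_of_le_of_ne hle fun heq => ?_) two_ne_zero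
    -- Equality in Cauchy–Schwarz would make `ψ` a multiple of `v`, hence of rank at most `K`.
    have heq' : ‖inner ℂ v ψ‖ = ‖v‖ * ‖ψ‖ := by rw [norm_inner_symm, heq, hψ, hv1, one_mul]
    obtain ⟨-, c, -, hc⟩ := (norm_inner_div_norm_mul_norm_eq_one_iff (𝕜 := ℂ) v ψ).1
      (by simpa [hψ, hv1] using heq')
    rw [hc] at hK
    exact absurd (hK.trans_le (rank_schmidtMatrix_smul_le c v)) (not_lt.2 hv.2)
  obtain ⟨c, hc, h⟩ := main
  refine ⟨c, hc, fun v hv => ?_⟩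
  rcases eq_or_ne v 0 with rfl | hv0
  · simp
  have hn : 0 < ‖v‖ := norm_pos_iff.2 hv0
  have := h (((‖v‖⁻¹ : ℝ) : ℂ) • v) ⟨by simp [norm_smul, hn.ne'],
    (rank_schmidtMatrix_smul_le _ v).trans hv⟩
  rw [inner_smul_right, norm_mul, mul_pow, Complex.norm_real, norm_inv, norm_norm, inv_pow,
    inv_mul_le_iff₀ (by positivity)] at this
  linarith

/-- The linear functional `X ↦ ⟨ψ|X|ψ⟩`. -/
def expectation {n : Type} [Fintype n] (ψ : n → ℂ) : Matrix n n ℂ →ₗ[ℂ] ℂ where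
  toFun X := star ψ ⬝ᵥ X.mulVec ψ
  map_add' X Y := by simp [Matrix.add_mulVec]
  map_smul' c X := by simp [Matrix.smul_mulVec]

theorem expectation_ketbra {n : Type} [Fintype n] (ψ v : EuclideanSpace ℂ n) :
    expectation (fun p => ψ p) (ketbra fun p => v p) = ((‖inner ℂ ψ v‖ ^ 2 : ℝ) : ℂ) := by
  have h1 : expectation (fun p => ψ p) (ketbra fun p => v p) = inner ℂ ψ v * inner ℂ v ψ := by
    simp only [expectation, LinearMap.coe_mk, AddHom.coe_mk, ketbra, Matrix.vecMulVec_mulVec,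
      PiLp.inner_apply, dotProduct, Pi.star_apply, RCLike.inner_apply]
    rw [mul_comm (Finset.sum _ _), Finset.sum_mul_sum, Finset.sum_comm]
    simp only [Pi.smul_apply, MulOpposite.smul_eq_mul_unop, MulOpposite.unop_op, Finset.mul_sum]
    exact Finset.sum_congr rfl fun x _ => Finset.sum_congr rfl fun y _ => by
      simp only [starRingEnd_apply]; ring
  rw [h1, ← inner_conj_symm v ψ, Complex.mul_conj, Complex.normSq_eq_norm_sq]

theorem trace_ketbra {n : Type} [Fintype n] (v : EuclideanSpace ℂ n) :
    (ketbra fun p => v p).trace = ((‖v‖ ^ 2 : ℝ) : ℂ) := by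
  rw [EuclideanSpace.norm_sq_eq, ketbra, Matrix.trace_vecMulVec]
  simp [dotProduct, Complex.mul_conj, Complex.normSq_eq_norm_sq]

/-- If the rank exceeded `K`, the functional `X ↦ c tr X - ⟨ψ|X|ψ⟩` would be nonnegative on the cone
by the overlap bound, yet equal to `c - 1 < 0` at `|ψ⟩⟨ψ|`. -/
theorem SchmidtNumberLE.rank_le {r α β : Type} [Fintype r] [Fintype α] [Fintype β] {K : ℕ}
    {ψ : EuclideanSpace ℂ (r × (α × β))} (hψ : ‖ψ‖ = 1)
    (h : SchmidtNumberLE K (ketbra fun p => ψ p)) : (schmidtMatrix fun p => ψ p).rank ≤ K := by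
  by_contra! hK
  obtain ⟨c, hc, hb⟩ := exists_overlap_bound hψ hK
  have h0 := h ((c : ℂ) • Matrix.traceLinearMap _ ℂ ℂ - expectation fun p => ψ p) fun v hv => by
    have := hb (WithLp.toLp 2 v) hv.rank_le
    have ht := trace_ketbra (WithLp.toLp 2 v)
    have he := expectation_ketbra ψ (WithLp.toLp 2 v)
    rw [LinearMap.sub_apply, LinearMap.smul_apply, Matrix.traceLinearMap_apply, smul_eq_mul,
      show ketbra v = ketbra fun p => (WithLp.toLp 2 v : EuclideanSpace ℂ _) p from rfl, ht, he,
      ← Complex.ofReal_mul, ← Complex.ofReal_sub, Complex.ofReal_re]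
    linarith
  rw [LinearMap.sub_apply, LinearMap.smul_apply, Matrix.traceLinearMap_apply, smul_eq_mul,
    trace_ketbra, expectation_ketbra, ← Complex.ofReal_mul, ← Complex.ofReal_sub,
    Complex.ofReal_re, hψ, inner_self_eq_norm_sq_to_K, hψ] at h0
  norm_num at h0
  linarith

theorem SplittingAchievable.rank_le {r a a' : Type} [Fintype r] [Fintype a] [Fintype a'] {K : ℕ}
    {ψ : EuclideanSpace ℂ (r × a × a')} (hψ : ‖ψ‖ = 1)
    (h : SplittingAchievable K fun p => ψ p) : (reducedLast fun p => ψ p).rank ≤ K := by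
  obtain ⟨S, hS, hout⟩ := h
  rw [rank_reducedLast]
  refine SchmidtNumberLE.rank_le hψ ?_
  rw [← hout]
  exact hS.preservesSchmidtNumberLE K _ (schmidtRankLE_splittingInput K _).schmidtNumberLE

/-! ### One-round protocols in Kraus form -/

/-- The instrument with one outcome that does nothing. -/
def Instrument.id (m : Type) [Fintype m] : Instrument m m where
  Outcome := Unit
  countable_outcome := inferInstance
  map _ := LinearMap.id
  cp _ _ _ hX := hX
  tp X := hasSum_unique fun _ : Unit => X.trace

theorem Instrument.isOneWayLocal_id (a b : Type) [Fintype a] [Fintype b] :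
    (Instrument.id (a × b)).IsOneWayLocal :=
  Or.inl fun _ => ⟨LinearMap.id, LinearMap.id, fun _ _ hX => hX,
    ⟨fun _ _ hX => hX, fun _ => rfl⟩, fun _ _ => rfl⟩

theorem Instrument.isCoarseGrainingOf_self {m n : Type} [Fintype m] [Fintype n]
    (J : Instrument m n) : J.IsCoarseGrainingOf J :=
  ⟨_root_.id, fun k _ => hasSum_single (⟨k, rfl⟩ : {i // _root_.id i = k})
    fun i hi => absurd (Subtype.ext i.2) hi⟩

theorem Instrument.isLinkedTo_self {a b a' b' : Type} [Fintype a] [Fintype b] [Fintype a']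
    [Fintype b'] (J : Instrument (a × b) (a' × b')) : J.IsLinkedTo J :=
  ⟨fun _ => Instrument.id _, fun _ => isOneWayLocal_id _ _, fun x => x.1, fun k _ =>
    hasSum_single
      (⟨⟨k, ()⟩, rfl⟩ : {x : Σ _ : J.Outcome, (Instrument.id (a' × b')).Outcome // x.1 = k}) <| by
        rintro ⟨⟨j, ⟨⟩⟩, rfl⟩ hx
        exact absurd rfl hx⟩

section

variable {I κ a b a' b' : Type} [Fintype I] [Fintype κ] [Fintype a'] [Fintype b']
  [DecidableEq a] [DecidableEq b]

theorem sum_conjTranspose_mul_kronecker {M : I → Matrix a' a ℂ} {L : I → κ → Matrix b' b ℂ}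
    (hM : ∑ i, (M i).conjTranspose * M i = 1)
    (hL : ∀ i, ∑ k, (L i k).conjTranspose * L i k = 1) :
    ∑ i, ∑ k, (M i ⊗ₖ L i k).conjTranspose * (M i ⊗ₖ L i k) = 1 := by
  have h : ∀ i, ∑ k, (M i ⊗ₖ L i k).conjTranspose * (M i ⊗ₖ L i k) =
      ((M i).conjTranspose * M i) ⊗ₖ (1 : Matrix b b ℂ) := fun i => by
    rw [← hL i]
    ext ⟨x, y⟩ ⟨x', y'⟩
    simp only [Matrix.conjTranspose_kronecker, ← Matrix.mul_kronecker_mul, Matrix.sum_apply,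
      Matrix.kroneckerMap_apply, Finset.mul_sum]
  simp only [h]
  rw [← Matrix.one_kronecker_one, ← hM]
  ext ⟨x, y⟩ ⟨x', y'⟩
  simp only [Matrix.sum_apply, Matrix.kroneckerMap_apply, Finset.sum_mul]

variable [Fintype a] [Fintype b]

/-- The first party measures with the Kraus operators `M i`, and after the outcome `i` the second
party applies the channel with the Kraus operators `L i k`. -/
def krausInstrument (M : I → Matrix a' a ℂ) (L : I → κ → Matrix b' b ℂ)
    (hM : ∑ i, (M i).conjTranspose * M i = 1)
    (hL : ∀ i, ∑ k, (L i k).conjTranspose * L i k = 1) : Instrument (a × b) (a' × b') where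
  Outcome := I
  countable_outcome := Finite.to_countable
  map i := krausMap fun k => M i ⊗ₖ L i k
  cp _ := isCP_krausMap _
  tp X := by
    convert hasSum_fintype _
    simp only [trace_krausMap]
    rw [← Matrix.trace_sum, ← Finset.sum_mul, sum_conjTranspose_mul_kronecker hM hL,
      Matrix.one_mul]

theorem isOneWayLocal_krausInstrument {M : I → Matrix a' a ℂ} {L : I → κ → Matrix b' b ℂ}
    (hM : ∑ i, (M i).conjTranspose * M i = 1)
    (hL : ∀ i, ∑ k, (L i k).conjTranspose * L i k = 1) :
    (krausInstrument M L hM hL).IsOneWayLocal := by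
  refine Or.inl fun i => ⟨krausMap fun _ : Unit => M i, krausMap (L i), isCP_krausMap _,
    isCPTP_krausMap _ (hL i), fun X Y => ?_⟩
  rw [← isTensor_krausMap]
  simp only [krausInstrument, krausMap_apply, Fintype.sum_prod_type, Finset.univ_unique,
    Finset.sum_singleton]

/-- The protocol sequence is constant: each later round does nothing, and the workspaces are
one-dimensional. -/
theorem isLOCC_krausMap {M : I → Matrix a' a ℂ} {L : I → κ → Matrix b' b ℂ}
    (hM : ∑ i, (M i).conjTranspose * M i = 1)
    (hL : ∀ i, ∑ k, (L i k).conjTranspose * L i k = 1) :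
    IsLOCC (krausMap fun p : I × κ => M p.1 ⊗ₖ L p.1 p.2) := by
  let M' : I → Matrix (a' × Fin 1) a ℂ := fun i => (M i).submatrix Prod.fst _root_.id
  let L' : I → κ → Matrix (b' × Fin 1) b ℂ := fun i k => (L i k).submatrix Prod.fst _root_.id
  have hM' : ∑ i, (M' i).conjTranspose * M' i = 1 := by
    rw [← hM]
    ext x y
    simp [M', Matrix.sum_apply, Matrix.mul_apply, Fintype.sum_prod_type]
  have hL' : ∀ i, ∑ k, (L' i k).conjTranspose * L' i k = 1 := fun i => by
    rw [← hL i]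
    ext x y
    simp [L', Matrix.sum_apply, Matrix.mul_apply, Fintype.sum_prod_type]
  have hloc := isOneWayLocal_krausInstrument hM' hL'
  refine ⟨fun _ => 1, fun _ => 1, fun _ => krausInstrument M' L' hM' hL',
    fun _ => krausMap fun p : I × κ => M p.1 ⊗ₖ L p.1 p.2,
    fun _ => IsFiniteLOCC.one _ _ hloc (Instrument.isCoarseGrainingOf_self _),
    fun _ => Instrument.isLinkedTo_self _, fun _ X => ?_, fun X => tendsto_const_nhds⟩
  have h : ∑ i, traceWork (krausMap (fun k => M' i ⊗ₖ L' i k) X) =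
      krausMap (fun p : I × κ => M p.1 ⊗ₖ L p.1 p.2) X := by
    ext ⟨x, y⟩ ⟨x', y'⟩
    rw [Matrix.sum_apply, krausMap_entry, Fintype.sum_prod_type]
    refine Finset.sum_congr rfl fun i _ => ?_
    simp only [traceWork, Matrix.of_apply, Finset.univ_unique, Finset.sum_singleton,
      krausMap_entry]
    rfl
  rw [← h]
  exact hasSum_fintype (β := I) _

end

/-! ### Splitting by teleportation -/

theorem inv_sqrt_mul_self_mul {K : ℕ} (hK : 0 < K) :
    ((1 / Real.sqrt K : ℝ) : ℂ) * ((1 / Real.sqrt K : ℝ) : ℂ) * (K : ℂ) = 1 := by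
  have h1 : (0 : ℝ) < K := by exact_mod_cast hK
  have h2 : 1 / Real.sqrt K * (1 / Real.sqrt K) * (K : ℝ) = 1 := by
    rw [div_mul_div_comm, Real.mul_self_sqrt h1.le]
    field_simp
  exact_mod_cast h2

/-- Measurement operators `m i : A' ⊗ Ā → ℂ` of the sender and correcting operations `L i` of the
receiver which reproduce `ψ` up to scalars achieve state splitting. -/
theorem splittingAchievable_of_kraus {I κ r a a' : Type} [Fintype I] [Fintype κ] [Fintype r]
    [Fintype a] [Fintype a'] [DecidableEq a'] {K : ℕ} (ψ : r × a × a' → ℂ)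
    (m : I → Matrix a' (Fin K) ℂ) (L : I → κ → Matrix a' (Fin K) ℂ) (c : I → κ → ℂ)
    (hm : ∀ s l s' l', ∑ i, star (m i s l) * m i s' l' = if s = s' ∧ l = l' then 1 else 0)
    (hL : ∀ i, ∑ k, (L i k).conjTranspose * L i k = 1)
    (hψ : ∀ i k x y, (L i k * (m i).transpose).mulVec (fun s => ψ (x, y, s)) =
      c i k • fun s => ψ (x, y, s))
    (hc : ∑ i, ∑ k, c i k * star (c i k) = K) (hK : 0 < K) :
    SplittingAchievable K ψ := by
  classical
  -- The sender keeps `A` and applies the functional with coefficients `m i` to `A' Ā`. Contracted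
  -- with the resource, it acts as `K^{-1/2} (m i)ᵀ` from `A'` to `B̄`.
  let M : I → Matrix a ((a × a') × Fin K) ℂ := fun i =>
    Matrix.of fun x y => if x = y.1.1 then m i y.1.2 y.2 else 0
  have hM : ∑ i, (M i).conjTranspose * M i = 1 := by
    ext ⟨⟨x, s⟩, l⟩ ⟨⟨x', s'⟩, l'⟩
    simp only [Matrix.sum_apply, Matrix.mul_apply, Matrix.conjTranspose_apply, M, Matrix.of_apply]
    have h : ∀ i, ∑ y, star (if y = x then m i s l else 0) * (if y = x' then m i s' l' else 0) =
        if x = x' then star (m i s l) * m i s' l' else 0 := fun i => by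
      rw [Finset.sum_eq_single x (fun b _ hb => by simp [hb]) (by simp)]
      split_ifs <;> simp_all
    simp only [h]
    by_cases hx : x = x'
    · simp only [hx, if_true, hm, Matrix.one_apply, Prod.mk.injEq, true_and]
    · simp [hx]
  refine ⟨_, isLOCC_krausMap hM hL, ?_⟩
  have hv : ∀ p : I × κ, ((1 : Matrix r r ℂ) ⊗ₖ (M p.1 ⊗ₖ L p.1 p.2)).mulVec
      (splittingInput K ψ) = (((1 / Real.sqrt K : ℝ) : ℂ) * c p.1 p.2) • ψ := by
    rintro ⟨i, k⟩
    ext ⟨x, y, t⟩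
    have h0 := congrFun (hψ i k x y) t
    simp only [Matrix.mulVec, dotProduct, Matrix.mul_apply, Matrix.transpose_apply,
      Pi.smul_apply, smul_eq_mul] at h0
    simp only [Pi.smul_apply, smul_eq_mul, mul_assoc, ← h0]
    simp only [Matrix.mulVec, dotProduct, Fintype.sum_prod_type, Matrix.kroneckerMap_apply,
      Matrix.one_apply, splittingInput, maxEntangled, M, Matrix.of_apply]
    rw [Finset.sum_eq_single x (fun b _ hb => by simp [hb.symm]) (by simp),
      Finset.sum_eq_single y (fun b _ hb => by simp [hb.symm]) (by simp), Finset.mul_sum]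
    refine Finset.sum_congr rfl fun s _ => ?_
    rw [Finset.sum_mul, Finset.mul_sum]
    refine Finset.sum_congr rfl fun l _ => ?_
    rw [Finset.sum_eq_single l (fun b _ hb => by simp [hb.symm]) (by simp)]
    simp only [if_true]
    ring
  rw [idTensor_krausMap, krausMap_ketbra]
  simp only [hv]
  ext p q
  have hstar : star ((1 / Real.sqrt K : ℝ) : ℂ) = ((1 / Real.sqrt K : ℝ) : ℂ) :=
    Complex.conj_ofReal _
  simp only [Matrix.sum_apply, ketbra, Matrix.vecMulVec_apply, Pi.smul_apply, Pi.star_apply,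
    smul_eq_mul, star_mul', hstar, Fintype.sum_prod_type]
  calc _ = ∑ i, ∑ k, (((1 / Real.sqrt K : ℝ) : ℂ) * ((1 / Real.sqrt K : ℝ) : ℂ)) *
        (c i k * star (c i k)) * (ψ p * star (ψ q)) :=
        Finset.sum_congr rfl fun i _ => Finset.sum_congr rfl fun k _ => by ring
    _ = ψ p * star (ψ q) := by
        simp only [← Finset.sum_mul, ← Finset.mul_sum, hc]
        rw [inv_sqrt_mul_self_mul hK, one_mul]

/-- Unitary operators on `ℂ^K` which form an orthogonal basis of the operators. -/
theorem exists_orthogonal_unitary_basis (K : ℕ) (hK : 0 < K) :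
    ∃ U : Fin K × Fin K → Matrix (Fin K) (Fin K) ℂ,
      (∀ i, U i * (U i).conjTranspose = 1) ∧
      ∀ j l j' l', ∑ i, U i j l * star (U i j' l') = if j = j' ∧ l = l' then (K : ℂ) else 0 := by
  classical
  have : NeZero K := ⟨hK.ne'⟩
  let e : Fin K ≃ ZMod K := Fintype.equivOfCardEq (by simp [ZMod.card])
  let χ := ZMod.stdAddChar (N := K)
  have hχ : ∀ t, star (χ t) = χ (-t) := fun t => by
    rw [AddChar.map_neg_eq_conj]; rfl
  have hχ1 : ∀ t, χ t * star (χ t) = 1 := fun t => by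
    rw [hχ, ← AddChar.map_add_eq_mul, add_neg_cancel, AddChar.map_zero_eq_one]
  -- These are the generalized Pauli operators, products of a cyclic shift by `p.1` and a phase
  -- given by a character with frequency `p.2`.
  refine ⟨fun p => Matrix.of fun j l => if e l = e j + e p.1 then χ (e p.2 * e j) else 0,
    fun p => ?_, fun j l j' l' => ?_⟩
  · ext j j'
    simp only [Matrix.mul_apply, Matrix.of_apply, Matrix.conjTranspose_apply, Matrix.one_apply]
    rw [Finset.sum_eq_single (e.symm (e j + e p.1))]
    · by_cases h : j = j'
      · subst h; simpa using hχ1 _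
      · simp [h]
    · intro b _ hb
      rw [if_neg (fun h => hb (by rw [← h, e.symm_apply_apply])), zero_mul]
    · simp
  · simp only [Matrix.of_apply, Fintype.sum_prod_type]
    -- Only the shift taking `j` to `l` contributes; the sum over phases is then character
    -- orthogonality.
    rw [Finset.sum_eq_single (e.symm (e l - e j))]
    · simp only [e.apply_symm_apply, add_sub_cancel, if_true]
      have hsum : ∑ z : Fin K, χ (e z * e j) * star (χ (e z * e j')) =
          if e j - e j' = 0 then (K : ℂ) else 0 := by
        have := AddChar.sum_mulShift (e j - e j') (ZMod.isPrimitive_stdAddChar K)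
        rw [ZMod.card, ← e.sum_comp, apply_ite Nat.cast, Nat.cast_zero] at this
        rw [← this]
        exact Finset.sum_congr rfl fun z _ => by
          rw [hχ, ← AddChar.map_add_eq_mul, mul_sub, sub_eq_add_neg]
      by_cases hj : j = j'
      · subst hj
        by_cases hl : l = l'
        · subst hl; simpa using hsum
        · simp [hl, Ne.symm hl]
      · have hj' : e j - e j' ≠ 0 := sub_ne_zero.2 (e.injective.ne hj)
        rw [if_neg hj'] at hsum
        rw [if_neg (by tauto)]
        by_cases h : e l' = e j' + (e l - e j)
        · simpa [h] using hsum
        · simp [h]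
    · intro b _ hb
      refine Finset.sum_eq_zero fun z _ => ?_
      rw [if_neg (fun h => hb ?_), zero_mul]
      rw [h, add_sub_cancel_left, e.symm_apply_apply]
    · simp

/-- The range of a matrix of rank at most `K` is contained in the range of a partial isometry
from `ℂ^K`. -/
theorem exists_partialIsometry {n m : Type} [Fintype n] [Fintype m] (A : Matrix n m ℂ) {K : ℕ}
    (hK : A.rank ≤ K) : ∃ W : Matrix n (Fin K) ℂ,
      W * W.conjTranspose * W = W ∧ W * W.conjTranspose * A = A := by
  classical
  have hρ : (A * A.conjTranspose).IsHermitian := Matrix.isHermitian_mul_conjTranspose_self A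
  have hcard : Fintype.card {i // hρ.eigenvalues i ≠ 0} ≤ Fintype.card (Fin K) := by
    rwa [← hρ.rank_eq_card_non_zero_eigs, Matrix.rank_self_mul_conjTranspose, Fintype.card_fin]
  obtain ⟨e⟩ := Function.Embedding.nonempty_of_card_le hcard
  let U : Matrix n n ℂ := hρ.eigenvectorUnitary
  have hU : U.conjTranspose * U = 1 := Unitary.coe_star_mul_self hρ.eigenvectorUnitary
  -- `S` places the eigenvectors with nonzero eigenvalue injectively among the `K` coordinates, so
  -- `U * S` has final projection onto the support of `A A†`.
  let S : Matrix n (Fin K) ℂ := Matrix.of fun i k => if ∃ h, e ⟨i, h⟩ = k then 1 else 0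
  let D : Matrix n n ℂ := Matrix.diagonal fun i => if hρ.eigenvalues i ≠ 0 then 1 else 0
  have hS : S * S.conjTranspose = D := by
    ext i j
    simp only [S, D, Matrix.mul_apply, Matrix.conjTranspose_apply, Matrix.of_apply,
      Matrix.diagonal_apply]
    by_cases hi : hρ.eigenvalues i ≠ 0
    · rw [Finset.sum_eq_single (e ⟨i, hi⟩)]
      · by_cases hj : i = j
        · subst hj; simp [hi]
        · have : ¬ ∃ h, e ⟨j, h⟩ = e ⟨i, hi⟩ := by
            rintro ⟨h, h'⟩
            exact hj (congrArg Subtype.val (e.injective h')).symm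
          rw [if_neg this, if_neg hj, star_zero, mul_zero]
      · intro b _ hb
        rw [if_neg (by rintro ⟨h, h'⟩; exact hb h'.symm), zero_mul]
      · simp
    · simp [hi]
  have hDS : D * S = S := by
    ext i k
    simp only [D, S, Matrix.diagonal_mul, Matrix.of_apply]
    by_cases hi : hρ.eigenvalues i ≠ 0
    · simp [hi]
    · have : ¬ ∃ h, e ⟨i, h⟩ = k := fun ⟨h, _⟩ => hi h
      simp [this]
  have hWW : (U * S) * (U * S).conjTranspose = U * D * U.conjTranspose := by
    rw [Matrix.conjTranspose_mul, ← hS]; simp only [Matrix.mul_assoc]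
  refine ⟨U * S, ?_, ?_⟩
  · rw [hWW]
    calc U * D * U.conjTranspose * (U * S) = U * D * (U.conjTranspose * U) * S := by
          simp only [Matrix.mul_assoc]
      _ = U * S := by rw [hU, Matrix.mul_one, Matrix.mul_assoc, hDS]
  · rw [hWW]
    have hspec : A * A.conjTranspose =
        U * Matrix.diagonal (fun i => (hρ.eigenvalues i : ℂ)) * U.conjTranspose := by
      conv_lhs => rw [hρ.spectral_theorem]
      rfl
    have hD : D * Matrix.diagonal (fun i => (hρ.eigenvalues i : ℂ)) =
        Matrix.diagonal (fun i => (hρ.eigenvalues i : ℂ)) := by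
      rw [Matrix.diagonal_mul_diagonal]
      congr 1
      ext i
      by_cases hi : hρ.eigenvalues i = 0 <;> simp [hi]
    have h1 : U * D * U.conjTranspose * (A * A.conjTranspose) = A * A.conjTranspose := by
      rw [hspec]
      calc _ = U * D * (U.conjTranspose * U) *
            Matrix.diagonal (fun i => (hρ.eigenvalues i : ℂ)) * U.conjTranspose := by
            simp only [Matrix.mul_assoc]
        _ = _ := by rw [hU, Matrix.mul_one, Matrix.mul_assoc U, hD]
    -- A matrix `B` vanishes as soon as `B B† = 0`, and the projection fixes `A A†`.
    have h2 : (1 - U * D * U.conjTranspose) * A = 0 := by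
      rw [← Matrix.self_mul_conjTranspose_eq_zero, Matrix.conjTranspose_mul, Matrix.mul_assoc,
        ← Matrix.mul_assoc A, ← Matrix.mul_assoc, Matrix.sub_mul, h1, Matrix.one_mul, sub_self,
        Matrix.zero_mul]
    rw [Matrix.sub_mul, Matrix.one_mul, sub_eq_zero] at h2
    exact h2.symm

/-- Teleportation of the support of `ψ^{A'}`: outcome `i` leaves the receiver with `U_i† W†` applied
to `ψ`, up to a scalar, and the correction `W U_i` restores `W W† ψ = ψ`. -/
theorem splittingAchievable_of_rank_le {r a a' : Type} [Fintype r] [Fintype a] [Fintype a']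
    {K : ℕ} (hK : 0 < K) [Nonempty a'] (ψ : r × a × a' → ℂ)
    (h : (Matrix.of fun (s : a') (p : r × a) => ψ (p.1, p.2, s)).rank ≤ K) :
    SplittingAchievable K ψ := by
  classical
  obtain ⟨W, hW, hWψ⟩ := exists_partialIsometry _ h
  obtain ⟨U, hU, hbasis⟩ := exists_orthogonal_unitary_basis K hK
  obtain ⟨s₀⟩ := ‹Nonempty a'›
  let P : Matrix a' a' ℂ := W * W.conjTranspose
  let Q : Matrix (Fin K) (Fin K) ℂ := 1 - W.conjTranspose * W
  have hPH : (1 - P).conjTranspose = 1 - P := by simp [P]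
  have hPP : (1 - P) * (1 - P) = 1 - P := by
    have : P * P = P := by simp only [P]; rw [← Matrix.mul_assoc, hW]
    rw [Matrix.mul_sub, Matrix.mul_one, Matrix.sub_mul, Matrix.one_mul, this, sub_self, sub_zero]
  have hQH : Q.conjTranspose = Q := by simp [Q]
  have hWW : W.conjTranspose * W * W.conjTranspose = W.conjTranspose := by
    simpa [Matrix.mul_assoc] using congrArg Matrix.conjTranspose hW
  have hQW : Q * W.conjTranspose = 0 := by simp [Q, Matrix.sub_mul, hWW]
  have hQQ : Q * Q = Q := by
    have : Q * (W.conjTranspose * W) = 0 := by rw [← Matrix.mul_assoc, hQW, Matrix.zero_mul]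
    nth_rw 2 [show Q = 1 - W.conjTranspose * W from rfl]
    rw [Matrix.mul_sub, this, Matrix.mul_one, sub_zero]
  have hPψ : ∀ x y, P.mulVec (fun s => ψ (x, y, s)) = fun s => ψ (x, y, s) := fun x y => by
    ext s
    exact congrFun (congrFun hWψ s) (x, y)
  let κ : ℂ := ((1 / Real.sqrt K : ℝ) : ℂ)
  have hκ : star κ = κ := Complex.conj_ofReal _
  have hκκ : κ * κ * K = 1 := inv_sqrt_mul_self_mul hK
  -- The left outcomes form a Bell measurement on the support, resolving `P ⊗ 1`. The right ones
  -- resolve `(1 - P) ⊗ 1` and never occur on `ψ`.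
  let m : (Fin K × Fin K) ⊕ (a' × Fin K) → Matrix a' (Fin K) ℂ :=
    Sum.elim (fun i => κ • (W * U i).map star)
      fun p => Matrix.of fun s l => if p.2 = l then (1 - P) p.1 s else 0
  let U' : (Fin K × Fin K) ⊕ (a' × Fin K) → Matrix (Fin K) (Fin K) ℂ := Sum.elim U fun _ => 1
  have hU' : ∀ i, (U' i).conjTranspose * U' i = 1 := by
    rintro (i | i)
    · exact mul_eq_one_comm.1 (hU i)
    · simp [U']
  -- `W` need not be an isometry, since `K` may exceed the dimension of `A'`. The terms `some k`
  -- send the complement of its initial space to the arbitrary basis vector `s₀`, which makes the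
  -- correction trace-preserving.
  let L : (Fin K × Fin K) ⊕ (a' × Fin K) → Option (Fin K) → Matrix a' (Fin K) ℂ := fun i k =>
    k.elim (W * U' i) fun k => Matrix.single s₀ k (1 : ℂ) * Q * U' i
  let c : (Fin K × Fin K) ⊕ (a' × Fin K) → Option (Fin K) → ℂ :=
    Sum.elim (fun _ k => k.elim κ fun _ => 0) fun _ _ => 0
  refine splittingAchievable_of_kraus ψ m L c (fun s l s' l' => ?_) (fun i => ?_) ?_ ?_ hK
  · rw [Fintype.sum_sum_type]
    have h1 : ∑ i, star (m (Sum.inl i) s l) * m (Sum.inl i) s' l' =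
        if l = l' then P s s' else 0 := by
      have : ∀ i, star (m (Sum.inl i) s l) * m (Sum.inl i) s' l' =
          ∑ j, ∑ j', κ * κ * (W s j * star (W s' j')) * (U i j l * star (U i j' l')) := fun i => by
        simp only [m, Sum.elim_inl, Matrix.smul_apply, smul_eq_mul, Matrix.map_apply, star_mul',
          star_star, hκ, Matrix.mul_apply, star_sum]
        rw [mul_mul_mul_comm, Finset.sum_mul_sum, Finset.mul_sum]
        refine Finset.sum_congr rfl fun j _ => ?_
        rw [Finset.mul_sum]
        exact Finset.sum_congr rfl fun j' _ => by ring
      simp only [this]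
      rw [Finset.sum_comm]
      simp only [fun j : Fin K => Finset.sum_comm (s := (Finset.univ : Finset (Fin K × Fin K)))
        (t := (Finset.univ : Finset (Fin K)))
        (f := fun i j' => κ * κ * (W s j * star (W s' j')) * (U i j l * star (U i j' l')))]
      simp only [← Finset.mul_sum, hbasis]
      by_cases hl : l = l'
      · simp only [hl, and_true, if_true, mul_ite, mul_zero, Finset.sum_ite_eq, Finset.mem_univ, P,
          Matrix.mul_apply, Matrix.conjTranspose_apply]
        exact Finset.sum_congr rfl fun j _ => by linear_combination W s j * star (W s' j) * hκκ
      · simp [hl]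
    have h2 : ∑ p, star (m (Sum.inr p) s l) * m (Sum.inr p) s' l' =
        if l = l' then (1 - P) s s' else 0 := by
      simp only [m, Sum.elim_inr, Matrix.of_apply, Fintype.sum_prod_type]
      by_cases hl : l = l'
      · subst hl
        rw [if_pos rfl]
        conv_rhs => rw [← hPP]
        rw [Matrix.mul_apply]
        refine Finset.sum_congr rfl fun t _ => ?_
        rw [Finset.sum_eq_single l (fun b _ hb => by simp [hb]) (by simp)]
        simp only [if_true]
        congr 1
        exact congrFun (congrFun hPH s) t
      · rw [if_neg hl]
        refine Finset.sum_eq_zero fun t _ => Finset.sum_eq_zero fun k _ => ?_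
        by_cases hk : k = l
        · subst hk; simp [hl]
        · simp [hk]
    rw [h1, h2]
    by_cases hl : l = l' <;> simp [hl, Matrix.one_apply]
  · rw [Fintype.sum_option]
    have h1 : ∑ k, (L i (some k)).conjTranspose * L i (some k) =
        (U' i).conjTranspose * Q * U' i := by
      have : ∀ k, (L i (some k)).conjTranspose * L i (some k) =
          (U' i).conjTranspose * Q * Matrix.single k k (1 : ℂ) * Q * U' i := fun k => by
        simp only [L, Option.elim, Matrix.conjTranspose_mul, hQH, Matrix.conjTranspose_single,
          star_one]
        calc _ = (U' i).conjTranspose * Q * (Matrix.single k s₀ (1 : ℂ) * Matrix.single s₀ k (1 : ℂ)) * Q *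
              U' i := by simp only [Matrix.mul_assoc]
          _ = _ := by rw [Matrix.single_mul_single_same, mul_one]
      simp only [this]
      rw [← Finset.sum_mul, ← Finset.sum_mul, ← Finset.mul_sum, Matrix.sum_single_one,
        Matrix.mul_one, Matrix.mul_assoc _ Q Q, hQQ]
    rw [h1, ← hU' i]
    simp only [L, Option.elim, Matrix.conjTranspose_mul, Q]
    simp only [Matrix.mul_sub, Matrix.sub_mul, Matrix.mul_one, Matrix.mul_assoc]
    abel
  · rintro (i | p) k x y
    · have hm : (m (Sum.inl i)).transpose = κ • ((U i).conjTranspose * W.conjTranspose) := by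
        rw [← Matrix.conjTranspose_mul]; rfl
      rw [hm, Matrix.mul_smul]
      have hUU : U' (Sum.inl i) * ((U i).conjTranspose * W.conjTranspose) = W.conjTranspose := by
        rw [← Matrix.mul_assoc]; simp only [U', Sum.elim_inl]; rw [hU, Matrix.one_mul]
      cases k with
      | none =>
        simp only [L, c, Option.elim, Sum.elim_inl]
        rw [Matrix.mul_assoc, hUU, Matrix.smul_mulVec, hPψ]
      | some k =>
        simp only [L, c, Option.elim, Sum.elim_inl]
        rw [Matrix.mul_assoc, hUU, Matrix.mul_assoc, hQW]
        simp
    · have hm : (m (Sum.inr p)).transpose = Matrix.single p.2 p.1 (1 : ℂ) * (1 - P) := by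
        ext l s
        simp only [m, Sum.elim_inr, Matrix.transpose_apply, Matrix.of_apply]
        by_cases hl : p.2 = l
        · subst hl; simp
        · simp [hl, Matrix.single_mul_apply_of_ne, Ne.symm hl]
      rw [hm, ← Matrix.mulVec_mulVec, ← Matrix.mulVec_mulVec, Matrix.sub_mulVec, hPψ]
      simp [c]
  · simp only [Fintype.sum_sum_type, Fintype.sum_option, c, Sum.elim_inl, Sum.elim_inr,
      Option.elim, hκ, zero_mul, Finset.sum_const_zero, add_zero, Finset.sum_const,
      Finset.card_univ, Fintype.card_prod, Fintype.card_fin, nsmul_eq_mul, Nat.cast_mul]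
    linear_combination (K : ℂ) * hκκ

end QLOCC

theorem theorem7 {r a a' : Type} [Fintype r] [Fintype a] [Fintype a']
    (ψ : EuclideanSpace ℂ (r × a × a')) (hψ : ‖ψ‖ = 1) (K : ℕ) (hK : 0 < K) :
    QLOCC.SplittingAchievable K (fun p => ψ p) ↔
      Real.logb 2 K ≥ Real.logb 2 ((QLOCC.reducedLast (fun p => ψ p)).rank : ℝ) := by
  have hlog : Real.logb 2 K ≥ Real.logb 2 ((QLOCC.reducedLast (fun p => ψ p)).rank : ℝ) ↔
      (QLOCC.reducedLast (fun p => ψ p)).rank ≤ K := by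
    rcases Nat.eq_zero_or_pos (QLOCC.reducedLast (fun p => ψ p)).rank with h | h
    -- `Real.logb 2 0` is `0` by convention, so for rank zero both sides hold because `K ≥ 1`.
    · simp only [h, Nat.cast_zero, Real.logb_zero, Nat.zero_le, iff_true]
      exact Real.logb_nonneg one_lt_two (by exact_mod_cast hK)
    · rw [ge_iff_le, Real.logb_le_logb one_lt_two (by exact_mod_cast h) (by exact_mod_cast hK),
        Nat.cast_le]
  rw [hlog]
  refine ⟨fun h => h.rank_le hψ, fun h => ?_⟩
  have : Nonempty a' := by
    by_contra hne
    rw [not_nonempty_iff] at hne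
    have : ψ = 0 := by ext p; exact hne.elim p.2.2
    simp [this] at hψ
  rw [QLOCC.rank_reducedLast, ← Matrix.rank_transpose] at h
  exact QLOCC.splittingAchievable_of_rank_le hK _ h
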